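/- **Conventions.** Let $\mathbf{Top}$ be the category of compactly generated weak Hausdorff spaces and continuous maps. A persistent object in a category $\mathcal C$ is a functor $F_\bullet:(\mathbb R,\le)\to\mathcal C$, with transition maps $f_a^b:F_a\to F_b$ for $a\le b$; a persistent space is a persistent object in $\mathbf{Top}$. For a partially ordered set $\mathcal N$, an $\mathcal N$-valued categorical invariant of $\mathcal C$ is an assignment $J:\mathrm{Ob}(\mathcal C)\sqcup\mathrm{Mor}(\mathcal C)\to\mathcal N$ with $J(\mathrm{id}_X)=J(X)$ for every object $X$ and $J(h\circ g\circ f)\le J(g)$ for all composable morphisms $f,g,h$. It assigns to a persistent object $F_\bullet$ the order-reversing map $J(F_\bullet):[a,b]\mapsto J(f_a^b)$ on the closed intervals $[a,b]$, $a\le b$, of $\mathbb R$, ordered by inclusion. For two order-reversing maps $\mathbf J_1,\mathbf J_2$ from these intervals to $\mathcal N$, the erosion distance $d_{\mathrm E}(\mathbf J_1,\mathbf J_2)\in[0,\infty]$ is the infimum of all $\epsilon\ge 0$ such that $\mathbf J_1([a,b])\ge \mathbf J_2([a-\epsilon,b+\epsilon])$ and $\mathbf J_2([a,b])\ge \mathbf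 J_1([a-\epsilon,b+\epsilon])$ for all $a\le b$ (and $\infty$ if there is none). The interleaving distance $d_{\mathrm I}(F_\bullet,G_\bullet)\in[0,\infty]$ is the infimum of all $\epsilon\ge0$ for which there are natural families $\varphi_t:F_t\to G_{t+\epsilon}$ and $\psi_t:G_t\to F_{t+\epsilon}$ ($t\in\mathbb R$) with $\psi_{t+\epsilon}\circ\varphi_t=f_t^{t+2\epsilon}$ and $\varphi_{t+\epsilon}\circ\psi_t=g_t^{t+2\epsilon}$ for all $t$. Two persistent spaces $X_\bullet,Y_\bullet$ are weakly equivalent, $X_\bullet\simeq Y_\bullet$, if there are a persistent space $Z_\bullet$ and natural transformations $X_\bullet\Leftarrow Z_\bullet\Rightarrow Y_\bullet$ all of whose components are weak homotopy equivalences. The homotopy interleaving distance is $$d_{\mathrm{HI}}(X_\bullet,Y_\bullet)=\inf\{d_{\mathrm I}(X'_\bullet,Y'_\bullet)\mid X'_\bullet\simeq X_\bullet,\ Y'_\bullet\simeq Y_\bullet\},$$ with $d_{\mathrm I}$ taken in $\mathbf{Top}$. For a metric space $X$ and $t\in\mathbb R$, $\mathrm{VR}_t(X)$ is the geometric realization (with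 the weak topology) of the simplicial complex of all nonempty finite subsets of $X$ of diameter at most $t$; in particular $\mathrm{VR}_t(X)=\emptyset$ for $t<0$. With the inclusions as transition maps this is a persistent space $\mathrm{VR}_\bullet(X)$. $d_{\mathrm{GH}}$ is the Gromov–Hausdorff distance. **Theorem (Homotopical stability).** Let $\mathcal N$ be a partially ordered set and let $J$ be an $\mathcal N$-valued categorical invariant of $\mathbf{Top}$ such that for any maps $X\xrightarrow{f}Y\xrightarrow{g}Z\xrightarrow{h}W$ in $\mathbf{Top}$ where $g$ is a weak homotopy equivalence, $J(g\circ f)=J(f)$ and $J(h\circ g)=J(h)$. Then for any two persistent spaces $X_\bullet,Y_\bullet:(\mathbb R,\le)\to\mathbf{Top}$, $$d_{\mathrm E}(J(X_\bullet),J(Y_\bullet))\le d_{\mathrm{HI}}(X_\bullet,Y_\bullet).$$ Moreover, for any nonempty compact metric spaces $X$ and $Y$, $$d_{\mathrm E}\bigl(J(\mathrm{VR}_\bullet(X)),J(\mathrm{VR}_\bullet(Y))\bigr)\le 2\cdot d_{\mathrm{GH}}(X,Y).$$ -/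

import Mathlib

open CategoryTheory
open scoped NNReal ENNReal Topology Topology.Homotopy

universe u v w

/-! ### Categorical invariants and the persistent invariants they induce -/

/-- An `N`-valued categorical invariant of a category `C`: a value for every object and every
morphism such that identities have the value of their object and `J (h ∘ g ∘ f) ≤ J g`. -/
structure CategoricalInvariant (C : Type u) [Category.{v} C] (N : Type w) [PartialOrder N] where
  obj : C → N
  map : ∀ {X Y : C}, (X ⟶ Y) → N
  map_id : ∀ X : C, map (𝟙 X) = obj X
  map_comp_comp_le : ∀ {X Y W Z : C} (f : X ⟶ Y) (g : Y ⟶ W) (h : W ⟶ Z),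
    map (f ≫ g ≫ h) ≤ map g

/-- The persistent invariant of a persistent object `F`: it sends `[a, b]` to the value of the
transition map `F_a ⟶ F_b`. `NonemptyInterval ℝ` is the poset of closed intervals `[a, b]`,
`a ≤ b`, ordered by inclusion, and `Nᵒᵈ` is `N` with the reversed order. -/
def CategoricalInvariant.persistent {C : Type u} [Category.{v} C] {N : Type w} [PartialOrder N]
    (J : CategoricalInvariant C N) (F : ℝ ⥤ C) : NonemptyInterval ℝ →o Nᵒᵈ where
  toFun I := OrderDual.toDual (J.map (F.map (homOfLE I.fst_le_snd)))
  monotone' I K h := by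
    obtain ⟨h₁, h₂⟩ := NonemptyInterval.le_def.1 h
    have := J.map_comp_comp_le (F.map (homOfLE h₁)) (F.map (homOfLE I.fst_le_snd))
      (F.map (homOfLE h₂))
    rw [← F.map_comp, ← F.map_comp] at this
    exact this

/-! ### Erosion distance -/

/-- The interval `[a - ε, b + ε]`. -/
def NonemptyInterval.thicken (I : NonemptyInterval ℝ) (ε : ℝ≥0) : NonemptyInterval ℝ where
  fst := I.fst - ε
  snd := I.snd + ε
  fst_le_snd := by
    have := I.fst_le_snd
    have := ε.coe_nonneg
    linarith

def IsEroded {N : Type w} [PartialOrder N] (ε : ℝ≥0) (J₁ J₂ : NonemptyInterval ℝ →o Nᵒᵈ) : Prop :=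
  ∀ I : NonemptyInterval ℝ,
    OrderDual.ofDual (J₂ (I.thicken ε)) ≤ OrderDual.ofDual (J₁ I) ∧
    OrderDual.ofDual (J₁ (I.thicken ε)) ≤ OrderDual.ofDual (J₂ I)

/-- The erosion distance; it is `∞` if there is no `ε` as required. -/
noncomputable def erosionDist {N : Type w} [PartialOrder N]
    (J₁ J₂ : NonemptyInterval ℝ →o Nᵒᵈ) : ℝ≥0∞ :=
  ⨅ (ε : ℝ≥0) (_ : IsEroded ε J₁ J₂), (ε : ℝ≥0∞)

/-! ### Interleaving distance -/

/-- The shifted persistent object `t ↦ F_{t + ε}`. -/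
abbrev persistentShift {C : Type u} [Category.{v} C] (ε : ℝ≥0) (F : ℝ ⥤ C) : ℝ ⥤ C where
  obj t := F.obj (t + ε)
  map f := F.map (homOfLE (add_le_add_left (leOfHom f) _))
  map_id t := F.map_id _
  map_comp f g := by rw [← F.map_comp]; rfl

theorem le_add_add_nnreal (t : ℝ) (ε : ℝ≥0) : t ≤ t + ε + ε := by
  have := ε.coe_nonneg
  linarith

def IsInterleaved {C : Type u} [Category.{v} C] (ε : ℝ≥0) (F G : ℝ ⥤ C) : Prop :=
  ∃ (φ : F ⟶ persistentShift ε G) (ψ : G ⟶ persistentShift ε F), ∀ t : ℝ,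
    ((φ.app t : F.obj t ⟶ G.obj (t + ε)) ≫
      (ψ.app (t + ε) : G.obj (t + ε) ⟶ F.obj (t + ε + ε)) =
        F.map (homOfLE (le_add_add_nnreal t ε))) ∧
    ((ψ.app t : G.obj t ⟶ F.obj (t + ε)) ≫
      (φ.app (t + ε) : F.obj (t + ε) ⟶ G.obj (t + ε + ε)) =
        G.map (homOfLE (le_add_add_nnreal t ε)))

noncomputable def interleavingDist {C : Type u} [Category.{v} C] (F G : ℝ ⥤ C) : ℝ≥0∞ :=
  ⨅ (ε : ℝ≥0) (_ : IsInterleaved ε F G), (ε : ℝ≥0∞)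

/-! ### Compactly generated weak Hausdorff spaces and weak homotopy equivalences -/

/-- A space is weak Hausdorff if every continuous image of a compact Hausdorff space in it is
closed. -/
def IsWeakHausdorff (X : Type u) [TopologicalSpace X] : Prop :=
  ∀ (K : Type u) [TopologicalSpace K] [CompactSpace K] [T2Space K] (f : K → X),
    Continuous f → IsClosed (Set.range f)

def isCGWH : ObjectProperty TopCat.{u} :=
  fun X => CompactlyGeneratedSpace X ∧ IsWeakHausdorff X

/-- The category of compactly generated weak Hausdorff spaces and continuous maps. -/
abbrev CGWH : Type (u + 1) := isCGWH.{u}.FullSubcategory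

section Homotopy

variable {X : Type u} {Y : Type v} [TopologicalSpace X] [TopologicalSpace Y]

/-- The map on path components induced by a continuous map. -/
def ZerothHomotopy.mapOfContinuous (f : C(X, Y)) : ZerothHomotopy X → ZerothHomotopy Y :=
  Quotient.map f fun _ _ ⟨p⟩ => ⟨p.map f.continuous⟩

/-- Composition of a generalized loop with a continuous map. -/
def GenLoop.mapOfContinuous (n : ℕ) (f : C(X, Y)) (x : X) (p : Ω^ (Fin n) X x) :
    Ω^ (Fin n) Y (f x) :=
  ⟨f.comp p.1, fun y hy => congrArg f (p.2 y hy)⟩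

/-- The map on the `n`-th homotopy groups induced by a continuous map. -/
def HomotopyGroup.mapOfContinuous (n : ℕ) (f : C(X, Y)) (x : X) : π_ n X x → π_ n Y (f x) :=
  Quotient.map (GenLoop.mapOfContinuous n f x) fun _ _ h => h.map fun H => H.compContinuousMap f

/-- A weak homotopy equivalence: a continuous map that induces a bijection on path components and,
for every base point, bijections on all homotopy groups (for `1 ≤ n` the induced maps are group
homomorphisms, so that bijective means isomorphism). -/
structure IsWeakHomotopyEquiv (f : C(X, Y)) : Prop where
  bijective_zerothHomotopy : Function.Bijective (ZerothHomotopy.mapOfContinuous f)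
  bijective_homotopyGroup : ∀ (n : ℕ) (x : X),
    Function.Bijective (HomotopyGroup.mapOfContinuous n f x)

end Homotopy

/-- A morphism of `CGWH` is a weak homotopy equivalence if the underlying continuous map is. -/
def CGWH.IsWeakEquiv {X Y : CGWH.{u}} (f : X ⟶ Y) : Prop :=
  IsWeakHomotopyEquiv f.hom.hom

/-! ### Homotopy interleaving distance -/

/-- Persistent spaces are weakly equivalent if they are connected by a span of natural
transformations that are objectwise weak homotopy equivalences. -/
def WeaklyEquivalent (X Y : ℝ ⥤ CGWH.{u}) : Prop :=
  ∃ (Z : ℝ ⥤ CGWH.{u}) (φ : Z ⟶ X) (ψ : Z ⟶ Y),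
    ∀ t : ℝ, CGWH.IsWeakEquiv (φ.app t) ∧ CGWH.IsWeakEquiv (ψ.app t)

noncomputable def homotopyInterleavingDist (X Y : ℝ ⥤ CGWH.{u}) : ℝ≥0∞ :=
  ⨅ (X' : ℝ ⥤ CGWH.{u}) (Y' : ℝ ⥤ CGWH.{u})
    (_ : WeaklyEquivalent X' X) (_ : WeaklyEquivalent Y' Y), interleavingDist X' Y'

/-! ### Geometric realization of abstract simplicial complexes -/

/-- The closed simplex spanned by a finite vertex set, in barycentric coordinates. -/
def closedSimplex {V : Type u} (s : Finset V) : Set (V → ℝ) :=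
  {p | (∀ v, 0 ≤ p v) ∧ (∀ v, v ∉ s → p v = 0) ∧ ∑ v ∈ s, p v = 1}

theorem isCompact_closedSimplex {V : Type u} (s : Finset V) : IsCompact (closedSimplex s) := by
  have hK : IsCompact (Set.pi Set.univ fun _ : V => Set.Icc (0 : ℝ) 1) :=
    isCompact_univ_pi fun _ => isCompact_Icc
  refine hK.of_isClosed_subset ?_ ?_
  · have h₁ : IsClosed {p : V → ℝ | ∀ v, 0 ≤ p v} := by
      simp only [Set.ofPred_forall]
      exact isClosed_iInter fun v => isClosed_le continuous_const (continuous_apply v)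
    have h₂ : IsClosed {p : V → ℝ | ∀ v, v ∉ s → p v = 0} := by
      simp only [Set.ofPred_forall]
      exact isClosed_iInter fun v => isClosed_iInter fun _ =>
        isClosed_eq (continuous_apply v) continuous_const
    have h₃ : IsClosed {p : V → ℝ | ∑ v ∈ s, p v = 1} :=
      isClosed_eq (continuous_finsetSum _ fun v _ => continuous_apply v) continuous_const
    exact h₁.inter (h₂.inter h₃)
  · rintro p ⟨h₀, h₁, h₂⟩ v -
    refine ⟨h₀ v, ?_⟩
    by_cases hv : v ∈ s
    · rw [← h₂]
      exact Finset.single_le_sum (fun i _ => h₀ i) hv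
    · rw [h₁ v hv]
      exact zero_le_one

/-- The points of the geometric realization: the barycentric coordinates of points that lie in the
closed simplex of some face. -/
@[ext]
structure Realization {V : Type u} (K : PreAbstractSimplicialComplex V) where
  weight : V → ℝ
  exists_face : ∃ s ∈ K, weight ∈ closedSimplex s

namespace Realization

variable {V : Type u} {K L : PreAbstractSimplicialComplex V}

/-- The inclusion of the closed simplex of a face. -/
def ofFace (s : {s : Finset V // s ∈ K}) (p : closedSimplex s.1) : Realization K :=
  ⟨p.1, s.1, s.2, p.2⟩

/-- The weak (coherent) topology: a set is open if and only if its trace on every closed simplex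
is open in the Euclidean topology of that simplex. -/
instance : TopologicalSpace (Realization K) :=
  ⨆ s : {s : Finset V // s ∈ K}, TopologicalSpace.coinduced (ofFace s) inferInstance

theorem continuous_iff {Z : Type v} [TopologicalSpace Z] {f : Realization K → Z} :
    Continuous f ↔ ∀ s : {s : Finset V // s ∈ K}, Continuous (f ∘ ofFace s) := by
  rw [continuous_iSup_dom]
  exact forall_congr' fun _ => continuous_coinduced_dom

theorem continuous_ofFace (s : {s : Finset V // s ∈ K}) : Continuous (ofFace s) :=
  continuous_iff.1 continuous_id s

theorem continuous_weight : Continuous (weight : Realization K → V → ℝ) :=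
  continuous_iff.2 fun _ => continuous_subtype_val

instance : T2Space (Realization K) :=
  T2Space.of_injective_continuous (fun _ _ h => Realization.ext h) continuous_weight

theorem isCGWH_of : isCGWH (TopCat.of (Realization K)) := by
  refine ⟨?_, fun T _ _ _ f hf => (isCompact_range hf).isClosed⟩
  refine compactlyGeneratedSpace_of_continuous_maps fun f h => continuous_iff.2 fun s => ?_
  have : CompactSpace (closedSimplex s.1) :=
    isCompact_iff_compactSpace.1 (isCompact_closedSimplex s.1)
  exact h (closedSimplex s.1) (ofFace s) (continuous_ofFace s)

/-- The inclusion of realizations induced by an inclusion of complexes. -/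
def inclusion (h : K ≤ L) : C(Realization K, Realization L) where
  toFun p := ⟨p.weight, let ⟨s, hs, hp⟩ := p.exists_face; ⟨s, h hs, hp⟩⟩
  continuous_toFun := continuous_iff.2 fun s => continuous_ofFace (K := L) ⟨s.1, h s.2⟩

end Realization

/-! ### Vietoris-Rips filtration -/

/-- The Vietoris-Rips complex at scale `t`: its faces are the nonempty finite subsets of diameter
at most `t`. In particular it has no faces if `t < 0`. -/
def vietorisRipsComplex (X : Type u) [PseudoMetricSpace X] (t : ℝ) :
    PreAbstractSimplicialComplex X where
  faces := {s | s.Nonempty ∧ Metric.diam (s : Set X) ≤ t}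
  isRelLowerSet_faces := fun s hs => ⟨hs.1, fun _ hr hr' =>
    ⟨hr', (Metric.diam_mono (Finset.coe_subset.2 hr) s.finite_toSet.isBounded).trans hs.2⟩⟩

theorem vietorisRipsComplex_mono (X : Type u) [PseudoMetricSpace X] {t t' : ℝ} (h : t ≤ t') :
    vietorisRipsComplex X t ≤ vietorisRipsComplex X t' :=
  fun _ hs => ⟨hs.1, hs.2.trans h⟩

/-- The Vietoris-Rips filtration: the geometric realizations of the Vietoris-Rips complexes, with
the inclusions as transition maps. -/
def vietorisRips (X : Type u) [PseudoMetricSpace X] : ℝ ⥤ CGWH.{u} where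
  obj t := ⟨TopCat.of (Realization (vietorisRipsComplex X t)), Realization.isCGWH_of⟩
  map f := ObjectProperty.homMk
    (TopCat.ofHom (Realization.inclusion (vietorisRipsComplex_mono X (leOfHom f))))
  map_id _ := rfl
  map_comp _ _ := rfl

/-!
If `F` and `G` are `ε`-interleaved, the transition map of `F` over `[a - ε, b + ε]` factors through
that of `G` over `[a, b]`, so an invariant can only decrease along the factorization. Weak
equivalences do not change the invariant, which gives stability for the homotopy interleaving
distance.

For compact `X` and `Y`, optimal isometric embeddings into a common space give a correspondence
`R ⊆ X × Y` of distortion at most `2 * ghDist X Y`. Pull the metrics of `X` and `Y` back to two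
pseudometrics on `R`. A section of the surjection `R → X` is an inverse of it up to contiguity, so
the Vietoris-Rips filtrations of `R` and `X` are weakly equivalent, and likewise for `Y`; the two
filtrations on `R` are interleaved by the identity of `R`. That homotopy equivalences are weak
homotopy equivalences is proved by change of base point along the tracks of a homotopy.
-/

section Stability

variable {C : Type u} [Category.{v} C] {N : Type w} [PartialOrder N]

theorem IsInterleaved.symm {ε : ℝ≥0} {F G : ℝ ⥤ C} (h : IsInterleaved ε F G) :
    IsInterleaved ε G F :=
  let ⟨φ, ψ, H⟩ := h
  ⟨ψ, φ, fun t => (H t).symm⟩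

theorem IsInterleaved.exists_map_eq {ε : ℝ≥0} {F G : ℝ ⥤ C} (h : IsInterleaved ε F G) {a b : ℝ}
    (hab : a + ε ≤ b) (hab' : a ≤ b + ε) :
    ∃ (φ : F.obj a ⟶ G.obj (a + ε)) (ψ : G.obj b ⟶ F.obj (b + ε)),
      F.map (homOfLE hab') = φ ≫ G.map (homOfLE hab) ≫ ψ := by
  obtain ⟨φ, ψ, H⟩ := h
  have hψ : G.map (homOfLE hab) ≫ (ψ.app b : G.obj b ⟶ F.obj (b + ε)) =
      (ψ.app (a + ε) : G.obj (a + ε) ⟶ F.obj (a + ε + ε)) ≫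
        F.map (homOfLE (add_le_add_left hab (ε : ℝ))) :=
    ψ.naturality (homOfLE hab)
  refine ⟨φ.app a, ψ.app b, ?_⟩
  rw [hψ, ← Category.assoc, (H a).1, ← F.map_comp]
  rfl

theorem IsInterleaved.map_thicken_le (J : CategoricalInvariant C N) {ε : ℝ≥0} {F G : ℝ ⥤ C}
    (h : IsInterleaved ε F G) {a b a' b' : ℝ} (hab : a ≤ b) (ha : a' + ε = a) (hb : b + ε = b')
    (hab' : a' ≤ b') : J.map (F.map (homOfLE hab')) ≤ J.map (G.map (homOfLE hab)) := by
  subst ha hb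
  obtain ⟨φ, ψ, hφψ⟩ := h.exists_map_eq hab hab'
  exact hφψ ▸ J.map_comp_comp_le _ _ _

theorem IsInterleaved.isEroded (J : CategoricalInvariant C N) {ε : ℝ≥0} {F G : ℝ ⥤ C}
    (h : IsInterleaved ε F G) : IsEroded ε (J.persistent F) (J.persistent G) := fun I =>
  ⟨h.symm.map_thicken_le J I.fst_le_snd (sub_add_cancel _ _) rfl (I.thicken ε).fst_le_snd,
    h.map_thicken_le J I.fst_le_snd (sub_add_cancel _ _) rfl (I.thicken ε).fst_le_snd⟩

theorem IsEroded.erosionDist_le {ε : ℝ≥0} {J₁ J₂ : NonemptyInterval ℝ →o Nᵒᵈ}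
    (h : IsEroded ε J₁ J₂) : erosionDist J₁ J₂ ≤ ε :=
  iInf₂_le (f := fun (ε : ℝ≥0) (_ : IsEroded ε J₁ J₂) => (ε : ℝ≥0∞)) ε h

theorem IsInterleaved.interleavingDist_le {ε : ℝ≥0} {F G : ℝ ⥤ C} (h : IsInterleaved ε F G) :
    interleavingDist F G ≤ ε :=
  iInf₂_le (f := fun (ε : ℝ≥0) (_ : IsInterleaved ε F G) => (ε : ℝ≥0∞)) ε h

theorem erosionDist_le_interleavingDist (J : CategoricalInvariant C N) (F G : ℝ ⥤ C) :
    erosionDist (J.persistent F) (J.persistent G) ≤ interleavingDist F G :=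
  le_iInf₂ fun _ h => (h.isEroded J).erosionDist_le

theorem WeaklyEquivalent.homotopyInterleavingDist_le {X Y X' Y' : ℝ ⥤ CGWH.{u}}
    (hX : WeaklyEquivalent X' X) (hY : WeaklyEquivalent Y' Y) :
    homotopyInterleavingDist X Y ≤ interleavingDist X' Y' :=
  (iInf₂_le X' Y').trans (iInf₂_le hX hY)

end Stability

section WeakInvariance

variable {N : Type w} [PartialOrder N] {J : CategoricalInvariant CGWH.{u} N}

/-- An invariant of spaces is weakly invariant if composing a map with a weak homotopy equivalence,
on either side, does not change its value. -/
def CategoricalInvariant.IsWeaklyInvariant (J : CategoricalInvariant CGWH.{u} N) : Prop :=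
  ∀ {X Y Z W : CGWH.{u}} (f : X ⟶ Y) (g : Y ⟶ Z) (h : Z ⟶ W), CGWH.IsWeakEquiv g →
    J.map (f ≫ g) = J.map f ∧ J.map (g ≫ h) = J.map h

namespace CategoricalInvariant.IsWeaklyInvariant

theorem persistent_eq_of_natTrans (hJ : J.IsWeaklyInvariant) {Z X : ℝ ⥤ CGWH.{u}} (φ : Z ⟶ X)
    (hφ : ∀ t, CGWH.IsWeakEquiv (φ.app t)) : J.persistent Z = J.persistent X := by
  ext I
  change J.map _ = J.map _
  rw [← (hJ (Z.map (homOfLE I.fst_le_snd)) (φ.app I.snd) (𝟙 _) (hφ _)).1, φ.naturality]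
  exact (hJ (𝟙 _) (φ.app I.fst) _ (hφ _)).2

theorem persistent_eq (hJ : J.IsWeaklyInvariant) {X Y : ℝ ⥤ CGWH.{u}}
    (h : WeaklyEquivalent X Y) : J.persistent X = J.persistent Y := by
  obtain ⟨Z, φ, ψ, H⟩ := h
  rw [← hJ.persistent_eq_of_natTrans φ fun t => (H t).1,
    hJ.persistent_eq_of_natTrans ψ fun t => (H t).2]

theorem erosionDist_le_homotopyInterleavingDist (hJ : J.IsWeaklyInvariant)
    (X Y : ℝ ⥤ CGWH.{u}) :
    erosionDist (J.persistent X) (J.persistent Y) ≤ homotopyInterleavingDist X Y :=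
  le_iInf₂ fun X' Y' => le_iInf₂ fun hX hY => by
    rw [← hJ.persistent_eq hX, ← hJ.persistent_eq hY]
    exact erosionDist_le_interleavingDist J X' Y'

end CategoricalInvariant.IsWeaklyInvariant

end WeakInvariance
section ChangeOfBasepoint

open scoped unitInterval

variable {N : Type v} {X : Type u} [TopologicalSpace X] {x₀ x₁ : X}

/-- The point of the unit cube nearest to `z`. -/
noncomputable def cubeClamp (z : N → ℝ) : N → I :=
  fun i => Set.projIcc 0 1 zero_le_one (z i)

/-- The dilation of the unit cube by the factor `1 + 2 * s` about its centre, onto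
`[-s, 1 + s]ᴺ`. -/
def cubeDilate (s : I) (y : N → I) : N → ℝ :=
  fun i => y i + s * (2 * y i - 1)

@[fun_prop] theorem continuous_cubeClamp : Continuous (cubeClamp : (N → ℝ) → N → I) :=
  continuous_pi fun i => continuous_projIcc.comp (continuous_apply i)

@[fun_prop] theorem continuous_cubeDilate {T : Type w} [TopologicalSpace T] {s : T → I}
    {y : T → N → I} (hs : Continuous s) (hy : Continuous y) :
    Continuous fun t => cubeDilate (s t) (y t) :=
  continuous_pi fun i => by
    unfold cubeDilate
    fun_prop

@[simp] theorem cubeDilate_zero (y : N → I) : cubeDilate 0 y = fun i => (y i : ℝ) :=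
  funext fun i => by simp [cubeDilate]

@[simp] theorem cubeClamp_coe (y : N → I) : cubeClamp (fun i => (y i : ℝ)) = y :=
  funext fun i => Set.projIcc_val zero_le_one (y i)

theorem cubeClamp_cubeDilate_mem_boundary {y : N → I} (hy : y ∈ Cube.boundary N) (s : I) :
    cubeClamp (cubeDilate s y) ∈ Cube.boundary N := by
  obtain ⟨i, hi⟩ := hy
  refine ⟨i, hi.imp (fun h => Set.projIcc_of_le_left _ ?_)
    fun h => Set.projIcc_of_right_le _ ?_⟩ <;>
  · have := s.2.1
    simp only [cubeDilate, h, Set.Icc.coe_zero, Set.Icc.coe_one]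
    linarith

theorem isClosed_cubeBoundary [Finite N] : IsClosed (Cube.boundary N) := by
  simp only [Cube.boundary, Set.ofPred_exists]
  exact isClosed_iUnion_of_finite fun i =>
    (isClosed_eq (continuous_apply i) continuous_const).union
      (isClosed_eq (continuous_apply i) continuous_const)

variable [Fintype N]

/-- The distance in the supremum norm from `z` to the unit cube. -/
noncomputable def cubeDist (z : N → ℝ) : ℝ :=
  dist z fun i => (cubeClamp z i : ℝ)

@[fun_prop] theorem continuous_cubeDist : Continuous (cubeDist : (N → ℝ) → ℝ) :=
  continuous_id.dist <| continuous_pi fun i =>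
    continuous_subtype_val.comp ((continuous_apply i).comp continuous_cubeClamp)

@[simp] theorem cubeDist_coe (y : N → I) : cubeDist (fun i => (y i : ℝ)) = 0 := by
  simp [cubeDist]

theorem cubeDist_eq_zero {z : N → ℝ} (hz : cubeClamp z ∉ Cube.boundary N) : cubeDist z = 0 := by
  refine dist_eq_zero.2 (funext fun i => ?_)
  have h : ¬(cubeClamp z i = 0 ∨ cubeClamp z i = 1) := fun h => hz ⟨i, h⟩
  have h₀ : 0 < z i := not_le.1 fun h' => h (.inl (Set.projIcc_of_le_left _ h'))
  have h₁ : z i < 1 := not_le.1 fun h' => h (.inr (Set.projIcc_of_right_le _ h'))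
  simp [cubeClamp, Set.projIcc_of_mem zero_le_one ⟨h₀.le, h₁.le⟩]

theorem cubeDist_cubeDilate {y : N → I} (hy : y ∈ Cube.boundary N) (s : I) :
    cubeDist (cubeDilate s y) = s := by
  have hs := s.2.1
  refine le_antisymm ((dist_pi_le_iff hs).2 fun i => ?_) ?_
  · have h₀ := (y i).2.1
    have h₁ := (y i).2.2
    simp only [cubeDilate, cubeClamp, Set.coe_projIcc, Real.dist_eq, abs_le]
    constructor <;> cases max_cases 0 (min 1 ((y i : ℝ) + s * (2 * y i - 1))) <;>
      cases min_cases 1 ((y i : ℝ) + s * (2 * y i - 1)) <;> nlinarith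
  · obtain ⟨i, hi⟩ := hy
    refine le_trans ?_ (dist_le_pi_dist _ _ i)
    rcases hi with hi | hi
    · have h : -(s : ℝ) ≤ 0 := neg_nonpos.2 hs
      simp [cubeDilate, cubeClamp, hi, Set.coe_projIcc, h, le_abs_self]
    · norm_num [Real.dist_eq, cubeDilate, cubeClamp, hi, Set.coe_projIcc, hs, le_abs_self]

open Classical in
/-- The extension of a map `b` of the unit cube to `ℝᴺ` that follows `γ` backwards with the
distance from the cube. It is meant for `b` with the constant value `x₁` on the boundary. -/
noncomputable def collarExtension (γ : Path x₀ x₁) (b : (N → I) → X) (z : N → ℝ) : X :=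
  if cubeClamp z ∈ Cube.boundary N then γ.extend (1 - cubeDist z) else b (cubeClamp z)

theorem collarExtension_of_mem {γ : Path x₀ x₁} {b : (N → I) → X} {z : N → ℝ}
    (hz : cubeClamp z ∈ Cube.boundary N) :
    collarExtension γ b z = γ.extend (1 - cubeDist z) :=
  if_pos hz

theorem collarExtension_of_notMem {γ : Path x₀ x₁} {b : (N → I) → X} {z : N → ℝ}
    (hz : cubeClamp z ∉ Cube.boundary N) : collarExtension γ b z = b (cubeClamp z) :=
  if_neg hz

theorem collarExtension_coe {γ : Path x₀ x₁} (β : Ω^ N X x₁) (y : N → I) :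
    collarExtension γ β (fun i => (y i : ℝ)) = β y := by
  by_cases hy : y ∈ Cube.boundary N
  · rw [collarExtension_of_mem (by rwa [cubeClamp_coe]), cubeDist_coe, sub_zero, γ.extend_one]
    exact (β.2 y hy).symm
  · rw [collarExtension_of_notMem (by rwa [cubeClamp_coe]), cubeClamp_coe]

theorem collarExtension_cubeDilate {γ : Path x₀ x₁} {b : (N → I) → X} {y : N → I}
    (hy : y ∈ Cube.boundary N) (s : I) :
    collarExtension γ b (cubeDilate s y) = γ.symm s := by
  rw [collarExtension_of_mem (cubeClamp_cubeDilate_mem_boundary hy s), cubeDist_cubeDilate hy]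
  exact γ.extend_apply (σ s).2

theorem continuous_collarExtension {T : Type w} [TopologicalSpace T] (γ : Path x₀ x₁)
    {b : T → (N → I) → X} {z : T → N → ℝ} (hz : Continuous z)
    (hb : Continuous fun t => b t (cubeClamp (z t)))
    (hb' : ∀ t, ∀ y ∈ Cube.boundary N, b t y = x₁) :
    Continuous fun t => collarExtension γ (b t) (z t) := by
  classical
  have hclosed : IsClosed {t | cubeClamp (z t) ∈ Cube.boundary N} :=
    isClosed_cubeBoundary.preimage (continuous_cubeClamp.comp hz)
  have hdist : Continuous fun t => cubeDist (z t) := continuous_cubeDist.comp hz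
  unfold collarExtension
  refine Continuous.if (fun t ht => ?_) (γ.continuous_extend.comp (continuous_const.sub hdist)) hb
  have ht' : cubeDist (z t) = 0 :=
    closure_minimal (fun t h => cubeDist_eq_zero h) (isClosed_eq hdist continuous_const)
      (frontier_eq_closure_inter_closure.subset ht).2
  rw [ht', sub_zero, γ.extend_one, hb' t _ (hclosed.frontier_subset ht)]

/-- Transport of generalized loops from the end of a path to its start. -/
noncomputable def changeBasepoint (γ : Path x₀ x₁) (β : Ω^ N X x₁) : Ω^ N X x₀ where
  val :=
    { toFun y := collarExtension γ β (cubeDilate 1 y)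
      continuous_toFun := by
        have hz : Continuous fun y : N → I => cubeDilate 1 y := by fun_prop
        exact continuous_collarExtension (b := fun _ => β) γ hz
          (β.1.continuous.comp (continuous_cubeClamp.comp hz)) fun _ => β.2 }
  property _ hy := (collarExtension_cubeDilate hy 1).trans γ.symm.target

theorem changeBasepoint_homotopic (γ : Path x₀ x₁) {β β' : Ω^ N X x₁}
    (h : GenLoop.Homotopic β β') :
    GenLoop.Homotopic (changeBasepoint γ β) (changeBasepoint γ β') := by
  obtain ⟨F⟩ := h
  refine ⟨⟨⟨⟨fun q => collarExtension γ (fun y => F (q.1, y)) (cubeDilate 1 q.2), ?_⟩,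
    fun y => ?_, fun y => ?_⟩, fun t y hy => ?_⟩⟩
  · have hz : Continuous fun q : I × (N → I) => cubeDilate 1 q.2 := by fun_prop
    refine continuous_collarExtension (b := fun q y => F (q.1, y)) γ hz
      (F.continuous.comp (continuous_fst.prodMk (continuous_cubeClamp.comp hz))) fun q y hy => ?_
    exact (F.eq_fst q.1 hy).trans (β.2 y hy)
  · simp only [F.apply_zero]
    rfl
  · simp only [F.apply_one]
    rfl
  · have h (b : (N → I) → X) : collarExtension γ b (cubeDilate 1 y) = γ.symm 1 :=
      collarExtension_cubeDilate hy 1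
    exact (h fun y => F (t, y)).trans (h β).symm

theorem homotopic_changeBasepoint {γ : Path x₀ x₁} {α : Ω^ N X x₀} {β : Ω^ N X x₁}
    (F : α.1.Homotopy β.1) (hF : ∀ t, ∀ y ∈ Cube.boundary N, F (t, y) = γ t) :
    GenLoop.Homotopic α (changeBasepoint γ β) := by
  -- At time `s`, apply `F` on the cube dilated by `s`, at a time that decreases from `s` with the
  -- distance from the cube: it is `0` on the boundary of the dilated cube, so the base point stays.
  let z (q : I × (N → I)) : N → ℝ := cubeDilate q.1 q.2
  have hz : Continuous z := by fun_prop
  let E (q : I × (N → I)) : X :=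
    F (Set.projIcc 0 1 zero_le_one (q.1 - cubeDist (z q)), cubeClamp (z q))
  have hu : Continuous fun q : I × (N → I) =>
      (Set.projIcc (0 : ℝ) 1 zero_le_one (q.1 - cubeDist (z q)), cubeClamp (z q)) :=
    (continuous_projIcc.comp (by fun_prop)).prodMk (by fun_prop)
  have hE : Continuous E := F.continuous.comp hu
  refine ⟨⟨⟨⟨E, hE⟩, fun y => ?_, fun y => ?_⟩, fun s y hy => ?_⟩⟩
  · simp [E, z]
  · by_cases hy : cubeClamp (cubeDilate 1 y) ∈ Cube.boundary N
    · exact (hF _ _ hy).trans (collarExtension_of_mem hy).symm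
    · have h : E (1, y) = β (cubeClamp (cubeDilate 1 y)) := by
        simp [E, z, cubeDist_eq_zero hy]
      exact h.trans (collarExtension_of_notMem hy).symm
  · have h : E (s, y) = γ 0 := by
      simp [E, z, hF _ _ (cubeClamp_cubeDilate_mem_boundary hy s), cubeDist_cubeDilate hy]
    exact h.trans (γ.source.trans (α.2 y hy).symm)

theorem homotopic_changeBasepoint_symm (γ : Path x₀ x₁) (β : Ω^ N X x₁) :
    GenLoop.Homotopic β (changeBasepoint γ.symm (changeBasepoint γ β)) := by
  let F : β.1.Homotopy (changeBasepoint γ β).1 :=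
    { toFun q := collarExtension γ β (cubeDilate q.1 q.2)
      continuous_toFun := by
        have hz : Continuous fun q : I × (N → I) => cubeDilate q.1 q.2 := by fun_prop
        exact continuous_collarExtension (b := fun _ => β) γ hz
          (β.1.continuous.comp (continuous_cubeClamp.comp hz)) fun _ => β.2
      map_zero_left y := by
        simp only [cubeDilate_zero]
        exact collarExtension_coe β y
      map_one_left y := rfl }
  exact homotopic_changeBasepoint F fun t y hy => collarExtension_cubeDilate hy t

/-- The bijection of homotopy groups induced by a path of base points. -/
noncomputable def changeBasepointEquiv (γ : Path x₀ x₁) :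
    HomotopyGroup N X x₁ ≃ HomotopyGroup N X x₀ where
  toFun := Quotient.map (changeBasepoint γ) fun _ _ => changeBasepoint_homotopic γ
  invFun := Quotient.map (changeBasepoint γ.symm) fun _ _ => changeBasepoint_homotopic γ.symm
  left_inv := by
    rintro ⟨β⟩
    exact Quotient.sound (homotopic_changeBasepoint_symm γ β).symm
  right_inv := by
    rintro ⟨α⟩
    have h := homotopic_changeBasepoint_symm γ.symm α
    rw [γ.symm_symm] at h
    exact Quotient.sound h.symm

end ChangeOfBasepoint

section HomotopyEquivalence

variable {X : Type*} {Y : Type*} {Z : Type*} {W : Type*} [TopologicalSpace X] [TopologicalSpace Y]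
  [TopologicalSpace Z] [TopologicalSpace W]

theorem zerothHomotopyMap_id : ZerothHomotopy.mapOfContinuous (ContinuousMap.id X) = id := by
  ext ⟨x⟩
  rfl

theorem zerothHomotopyMap_comp (g : C(Y, Z)) (f : C(X, Y)) :
    ZerothHomotopy.mapOfContinuous (g.comp f) =
      ZerothHomotopy.mapOfContinuous g ∘ ZerothHomotopy.mapOfContinuous f := by
  ext ⟨x⟩
  rfl

theorem zerothHomotopyMap_eq_of_homotopy {f g : C(X, Y)} (H : f.Homotopy g) :
    ZerothHomotopy.mapOfContinuous f = ZerothHomotopy.mapOfContinuous g := by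
  ext ⟨x⟩
  exact Quotient.sound ⟨H.evalAt x⟩

theorem homotopyGroupMap_id (n : ℕ) (x : X) :
    HomotopyGroup.mapOfContinuous n (ContinuousMap.id X) x = id := by
  ext ⟨α⟩
  rfl

theorem homotopyGroupMap_comp (g : C(Y, Z)) (f : C(X, Y)) (n : ℕ) (x : X) :
    HomotopyGroup.mapOfContinuous n (g.comp f) x =
      HomotopyGroup.mapOfContinuous n g (f x) ∘ HomotopyGroup.mapOfContinuous n f x := by
  ext ⟨α⟩
  rfl

theorem homotopyGroupMap_eq_changeBasepointEquiv_comp {f g : C(X, Y)} (H : f.Homotopy g) (n : ℕ)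
    (x : X) : HomotopyGroup.mapOfContinuous n f x =
      changeBasepointEquiv (H.evalAt x) ∘ HomotopyGroup.mapOfContinuous n g x := by
  ext ⟨α⟩
  refine Quotient.sound (homotopic_changeBasepoint (H.compContinuousMap α.1) fun t y hy => ?_)
  exact congrArg (fun x => H (t, x)) (α.2 y hy)

theorem IsWeakHomotopyEquiv.id : IsWeakHomotopyEquiv (ContinuousMap.id X) where
  bijective_zerothHomotopy :=
    zerothHomotopyMap_id (X := X) ▸ Function.bijective_id
  bijective_homotopyGroup n x := homotopyGroupMap_id n x ▸ Function.bijective_id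

theorem IsWeakHomotopyEquiv.of_homotopy {f g : C(X, Y)} (hf : IsWeakHomotopyEquiv f)
    (H : f.Homotopy g) : IsWeakHomotopyEquiv g where
  bijective_zerothHomotopy := zerothHomotopyMap_eq_of_homotopy H ▸ hf.bijective_zerothHomotopy
  bijective_homotopyGroup n x := by
    have h := hf.bijective_homotopyGroup n x
    rw [homotopyGroupMap_eq_changeBasepointEquiv_comp H] at h
    exact (Function.Bijective.of_comp_iff' (changeBasepointEquiv (H.evalAt x)).bijective _).1 h

theorem bijective_of_comp_of_comp {α β γ δ : Type*} {f : α → β} {g : β → γ} {h : γ → δ}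
    (hgf : Function.Bijective (g ∘ f)) (hhg : Function.Bijective (h ∘ g)) :
    Function.Bijective f :=
  (Function.Bijective.of_comp_iff' ⟨hhg.1.of_comp, hgf.2.of_comp⟩ f).1 hgf

theorem IsWeakHomotopyEquiv.of_comp_of_comp {f : C(X, Y)} {g : C(Y, Z)} {h : C(Z, W)}
    (hgf : IsWeakHomotopyEquiv (g.comp f)) (hhg : IsWeakHomotopyEquiv (h.comp g)) :
    IsWeakHomotopyEquiv f where
  bijective_zerothHomotopy :=
    bijective_of_comp_of_comp (zerothHomotopyMap_comp g f ▸ hgf.bijective_zerothHomotopy)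
      (zerothHomotopyMap_comp h g ▸ hhg.bijective_zerothHomotopy)
  bijective_homotopyGroup n x :=
    bijective_of_comp_of_comp (homotopyGroupMap_comp g f n x ▸ hgf.bijective_homotopyGroup n x)
      (homotopyGroupMap_comp h g n (f x) ▸ hhg.bijective_homotopyGroup n (f x))

theorem IsWeakHomotopyEquiv.of_homotopyEquiv (e : ContinuousMap.HomotopyEquiv X Y) :
    IsWeakHomotopyEquiv e.toFun :=
  .of_comp_of_comp (IsWeakHomotopyEquiv.id.of_homotopy e.left_inv.some.symm)
    (IsWeakHomotopyEquiv.id.of_homotopy e.right_inv.some.symm)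

end HomotopyEquivalence

section Simplicial

variable {V V' U : Type*} {K : PreAbstractSimplicialComplex V}
  {L : PreAbstractSimplicialComplex V'} {M : PreAbstractSimplicialComplex U}

/-- A map of vertices is simplicial if the image of a face of `K` lies in a face of `L`. Asking for
containment instead of equality avoids decidable equality on the vertices, and amounts to the same
because nonempty subsets of faces are faces. -/
def IsSimplicial (K : PreAbstractSimplicialComplex V) (L : PreAbstractSimplicialComplex V')
    (f : V → V') : Prop :=
  ∀ s ∈ K, ∃ t ∈ L, ∀ x ∈ s, f x ∈ t

/-- Contiguity of two maps of vertices: the images of a face of `K` under `f` and `g` lie in a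
common face of `L`. In particular both maps are simplicial. -/
def IsContiguous (K : PreAbstractSimplicialComplex V) (L : PreAbstractSimplicialComplex V')
    (f g : V → V') : Prop :=
  ∀ s ∈ K, ∃ t ∈ L, ∀ x ∈ s, f x ∈ t ∧ g x ∈ t

theorem IsContiguous.symm {f g : V → V'} (h : IsContiguous K L f g) : IsContiguous K L g f :=
  fun s hs => let ⟨t, ht, hst⟩ := h s hs; ⟨t, ht, fun x hx => (hst x hx).symm⟩

theorem IsContiguous.left {f g : V → V'} (h : IsContiguous K L f g) : IsSimplicial K L f :=
  fun s hs => let ⟨t, ht, hst⟩ := h s hs; ⟨t, ht, fun x hx => (hst x hx).1⟩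

theorem isSimplicial_id {K L : PreAbstractSimplicialComplex V} (h : K ≤ L) : IsSimplicial K L id :=
  fun s hs => ⟨s, h hs, fun _ hx => hx⟩

theorem IsSimplicial.comp {g : V' → U} {f : V → V'} (hg : IsSimplicial L M g)
    (hf : IsSimplicial K L f) : IsSimplicial K M (g ∘ f) := fun s hs =>
  let ⟨t, ht, hst⟩ := hf s hs
  let ⟨r, hr, htr⟩ := hg t ht
  ⟨r, hr, fun x hx => htr _ (hst x hx)⟩

theorem convex_closedSimplex (s : Finset V) : Convex ℝ (closedSimplex s) := by
  rintro p ⟨hp₀, hp₁, hp₂⟩ q ⟨hq₀, hq₁, hq₂⟩ a b ha hb hab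
  refine ⟨fun v => ?_, fun v hv => ?_, ?_⟩
  · exact add_nonneg (mul_nonneg ha (hp₀ v)) (mul_nonneg hb (hq₀ v))
  · simp [hp₁ v hv, hq₁ v hv]
  · simp [Finset.sum_add_distrib, ← Finset.mul_sum, hp₂, hq₂, hab]

theorem single_mem_closedSimplex {s : Finset V} {v : V} (hv : v ∈ s) :
    ⇑(Finsupp.single v (1 : ℝ)) ∈ closedSimplex s := by
  classical
  refine ⟨fun w => ?_, fun w hw => Finsupp.single_eq_of_ne ?_, ?_⟩
  · rw [Finsupp.single_apply]
    split_ifs <;> norm_num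
  · rintro rfl
    exact hw hv
  · simp [Finsupp.single_apply, hv]

namespace Realization

theorem finite_support_weight (p : Realization K) : p.weight.support.Finite := by
  obtain ⟨s, -, hs⟩ := p.exists_face
  exact s.finite_toSet.subset fun v hv => by_contra fun h => hv (hs.2.1 v h)

/-- The barycentric coordinates as a finitely supported function, which are pushed forward along
maps of vertices by `Finsupp.mapDomain`. -/
noncomputable def finsupp (p : Realization K) : V →₀ ℝ :=
  Finsupp.ofSupportFinite p.weight p.finite_support_weight

theorem mapDomain_finsupp {p : Realization K} {s : Finset V} (hp : p.weight ∈ closedSimplex s)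
    (f : V → V') :
    ⇑(p.finsupp.mapDomain f) = ∑ x ∈ s, p.weight x • ⇑(Finsupp.single (f x) (1 : ℝ)) := by
  have h : p.finsupp.support ⊆ s := fun v hv =>
    by_contra fun h => Finsupp.mem_support_iff.1 hv (hp.2.1 v h)
  rw [Finsupp.mapDomain, Finsupp.sum_of_support_subset _ h _ fun _ _ => Finsupp.single_zero _]
  ext w
  simp only [Finsupp.finsetSum_apply, Finset.sum_apply, Pi.smul_apply, smul_eq_mul,
    ← Finsupp.smul_single_one _ (p.finsupp _), Finsupp.smul_apply]
  rfl

theorem mapDomain_finsupp_mem {p : Realization K} {s : Finset V}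
    (hp : p.weight ∈ closedSimplex s) {f : V → V'} {t : Finset V'} (hf : ∀ x ∈ s, f x ∈ t) :
    ⇑(p.finsupp.mapDomain f) ∈ closedSimplex t := by
  rw [mapDomain_finsupp hp]
  exact (convex_closedSimplex t).sum_mem (fun x _ => hp.1 x) hp.2.2
    fun x hx => single_mem_closedSimplex (hf x hx)

theorem lineMap_mapDomain_finsupp_mem {p : Realization K} {s : Finset V}
    (hp : p.weight ∈ closedSimplex s) {f g : V → V'} {t : Finset V'}
    (hfg : ∀ x ∈ s, f x ∈ t ∧ g x ∈ t) (r : unitInterval) :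
    AffineMap.lineMap ⇑(p.finsupp.mapDomain f) ⇑(p.finsupp.mapDomain g) (r : ℝ) ∈
      closedSimplex t :=
  (convex_closedSimplex t).lineMap_mem (mapDomain_finsupp_mem hp fun x hx => (hfg x hx).1)
    (mapDomain_finsupp_mem hp fun x hx => (hfg x hx).2) r.2

theorem continuous_mapDomain_finsupp (f : V → V') (s : {s : Finset V // s ∈ K}) :
    Continuous fun p : closedSimplex s.1 => ⇑((ofFace s p).finsupp.mapDomain f) := by
  have h (p : closedSimplex s.1) : ⇑((ofFace s p).finsupp.mapDomain f) =
      ∑ x ∈ s.1, p.1 x • ⇑(Finsupp.single (f x) (1 : ℝ)) :=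
    mapDomain_finsupp p.2 f
  simp only [h]
  exact continuous_finsetSum _ fun x _ =>
    ((continuous_apply x).comp continuous_subtype_val).smul continuous_const

theorem continuous_of_weight_mem_closedSimplex {T : Type w} [TopologicalSpace T]
    {F : T → Realization L} (t : {t : Finset V' // t ∈ L})
    (ht : ∀ x, (F x).weight ∈ closedSimplex t.1) (hF : Continuous fun x => (F x).weight) :
    Continuous F :=
  (continuous_ofFace t).comp (hF.subtype_mk ht)

theorem continuous_prod_iff {T : Type w} [TopologicalSpace T] [LocallyCompactSpace T] {Z : Type v}
    [TopologicalSpace Z] {F : T × Realization K → Z} : Continuous F ↔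
      ∀ s : {s : Finset V // s ∈ K}, Continuous fun q : T × closedSimplex s.1 =>
        F (q.1, ofFace s q.2) := by
  refine ⟨fun hF s => hF.comp (continuous_fst.prodMk
    ((continuous_ofFace s).comp continuous_snd)), fun hF => ?_⟩
  have hline (p : Realization K) : Continuous fun t => F (t, p) := by
    obtain ⟨s, hs, hp⟩ := p.exists_face
    exact (hF ⟨s, hs⟩).comp (Continuous.prodMk_left ⟨p.weight, hp⟩)
  -- A map out of a product with a colimit is handled by currying, as `T` is exponentiable.
  let G : Realization K → C(T, Z) := fun p => ⟨fun t => F (t, p), hline p⟩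
  have hG : Continuous G := continuous_iff.2 fun s =>
    ContinuousMap.continuous_of_continuous_uncurry _ ((hF s).comp continuous_swap)
  exact (ContinuousMap.continuous_uncurry_of_continuous ⟨G, hG⟩).comp continuous_swap

/-- The map of realizations induced by a simplicial map. -/
noncomputable def map (f : V → V') (hf : IsSimplicial K L f) :
    C(Realization K, Realization L) where
  toFun p := ⟨p.finsupp.mapDomain f, by
    obtain ⟨s, hs, hp⟩ := p.exists_face
    obtain ⟨t, ht, hst⟩ := hf s hs
    exact ⟨t, ht, mapDomain_finsupp_mem hp hst⟩⟩
  continuous_toFun := continuous_iff.2 fun s => by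
    obtain ⟨t, ht, hst⟩ := hf s.1 s.2
    exact continuous_of_weight_mem_closedSimplex ⟨t, ht⟩
      (fun p => mapDomain_finsupp_mem (p := ofFace s p) p.2 hst) (continuous_mapDomain_finsupp f s)

theorem finsupp_map {f : V → V'} (hf : IsSimplicial K L f) (p : Realization K) :
    (map f hf p).finsupp = p.finsupp.mapDomain f :=
  DFunLike.coe_injective rfl

theorem map_comp {g : V' → U} {f : V → V'} (hg : IsSimplicial L M g) (hf : IsSimplicial K L f) :
    map (g ∘ f) (hg.comp hf) = (map g hg).comp (map f hf) := by
  ext1 p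
  refine Realization.ext ?_
  change ⇑(p.finsupp.mapDomain (g ∘ f)) = ⇑((map f hf p).finsupp.mapDomain g)
  rw [finsupp_map, Finsupp.mapDomain_comp]

theorem map_id {K L : PreAbstractSimplicialComplex V} (h : K ≤ L) :
    map id (isSimplicial_id h) = inclusion h := by
  ext1 p
  exact Realization.ext (congrArg DFunLike.coe Finsupp.mapDomain_id)

/-- Contiguous simplicial maps are joined by the straight-line homotopy, which stays in the faces
that contain both images. -/
noncomputable def homotopyOfContiguous {f g : V → V'} (h : IsContiguous K L f g) :
    (map f h.left).Homotopy (map g h.symm.left) where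
  toFun q := ⟨AffineMap.lineMap ⇑(q.2.finsupp.mapDomain f) ⇑(q.2.finsupp.mapDomain g)
      (q.1 : ℝ), by
    obtain ⟨s, hs, hp⟩ := q.2.exists_face
    obtain ⟨t, ht, hst⟩ := h s hs
    exact ⟨t, ht, lineMap_mapDomain_finsupp_mem hp hst q.1⟩⟩
  continuous_toFun := continuous_prod_iff.2 fun s => by
    obtain ⟨t, ht, hst⟩ := h s.1 s.2
    refine continuous_of_weight_mem_closedSimplex ⟨t, ht⟩
      (fun q => lineMap_mapDomain_finsupp_mem (p := ofFace s q.2) q.2.2 hst q.1) ?_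
    exact ((continuous_mapDomain_finsupp f s).comp continuous_snd).lineMap
      ((continuous_mapDomain_finsupp g s).comp continuous_snd)
      (continuous_subtype_val.comp continuous_fst)
  map_zero_left p := Realization.ext (by simp [map])
  map_one_left p := Realization.ext (by simp [map])

/-- Two simplicial maps that are inverse up to contiguity induce a homotopy equivalence. -/
noncomputable def homotopyEquivOfContiguous {f : V → V'} {g : V' → V} (hf : IsSimplicial K L f)
    (hg : IsSimplicial L K g) (hgf : IsContiguous K K (g ∘ f) id)
    (hfg : IsContiguous L L (f ∘ g) id) :
    ContinuousMap.HomotopyEquiv (Realization K) (Realization L) where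
  toFun := map f hf
  invFun := map g hg
  left_inv := ⟨(homotopyOfContiguous hgf).cast (map_comp hg hf) (map_id le_rfl)⟩
  right_inv := ⟨(homotopyOfContiguous hfg).cast (map_comp hf hg) (map_id le_rfl)⟩

end Realization

end Simplicial

section VietorisRips

theorem mem_vietorisRipsComplex_iff {X : Type u} [PseudoMetricSpace X] {t : ℝ} {s : Finset X} :
    s ∈ vietorisRipsComplex X t ↔ s.Nonempty ∧ ∀ x ∈ s, ∀ y ∈ s, dist x y ≤ t := by
  constructor
  · rintro ⟨hs, hd⟩
    exact ⟨hs, fun x hx y hy =>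
      (Metric.dist_le_diam_of_mem s.finite_toSet.isBounded hx hy).trans hd⟩
  · rintro ⟨⟨x, hx⟩, hd⟩
    refine ⟨⟨x, hx⟩, Metric.diam_le_of_forall_dist_le ?_ hd⟩
    simpa using hd x hx x hx

variable {X Y Z : Type u} [PseudoMetricSpace X] [PseudoMetricSpace Y] [PseudoMetricSpace Z]
  {t t' t'' : ℝ}

theorem isSimplicial_vietorisRips {f : X → Y}
    (hf : ∀ x x', dist x x' ≤ t → dist (f x) (f x') ≤ t') :
    IsSimplicial (vietorisRipsComplex X t) (vietorisRipsComplex Y t') f := fun s hs => by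
  classical
  obtain ⟨hne, hd⟩ := mem_vietorisRipsComplex_iff.1 hs
  refine ⟨s.image f, mem_vietorisRipsComplex_iff.2 ⟨hne.image f, ?_⟩,
    fun x hx => Finset.mem_image_of_mem f hx⟩
  simp only [Finset.forall_mem_image]
  exact fun x hx x' hx' => hf x x' (hd x hx x' hx')

theorem isContiguous_vietorisRips {f g : X → Y}
    (hf : ∀ x x', dist x x' ≤ t → dist (f x) (f x') ≤ t')
    (hg : ∀ x x', dist x x' ≤ t → dist (g x) (g x') ≤ t')
    (hfg : ∀ x x', dist x x' ≤ t → dist (f x) (g x') ≤ t') :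
    IsContiguous (vietorisRipsComplex X t) (vietorisRipsComplex Y t') f g := fun s hs => by
  classical
  obtain ⟨hne, hd⟩ := mem_vietorisRipsComplex_iff.1 hs
  refine ⟨s.image f ∪ s.image g, mem_vietorisRipsComplex_iff.2
    ⟨(hne.image f).mono Finset.subset_union_left, ?_⟩, fun x hx =>
      ⟨Finset.mem_union_left _ (Finset.mem_image_of_mem f hx),
        Finset.mem_union_right _ (Finset.mem_image_of_mem g hx)⟩⟩
  simp only [Finset.forall_mem_union, Finset.forall_mem_image]
  refine ⟨fun x hx => ⟨fun y hy => ?_, fun y hy => ?_⟩,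
    fun x hx => ⟨fun y hy => ?_, fun y hy => ?_⟩⟩
  · exact hf x y (hd x hx y hy)
  · exact hfg x y (hd x hx y hy)
  · exact dist_comm (f y) (g x) ▸ hfg y x (hd y hy x hx)
  · exact hg x y (hd x hx y hy)

/-- The map of Vietoris-Rips complexes, from scale `t` to scale `t'`, induced by a map of points. -/
noncomputable def vietorisRipsMap (f : X → Y)
    (hf : ∀ x x', dist x x' ≤ t → dist (f x) (f x') ≤ t') :
    (vietorisRips X).obj t ⟶ (vietorisRips Y).obj t' :=
  ObjectProperty.homMk (TopCat.ofHom (Realization.map f (isSimplicial_vietorisRips hf)))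

theorem vietorisRipsMap_comp {f : X → Y} {g : Y → Z}
    (hf : ∀ x x', dist x x' ≤ t → dist (f x) (f x') ≤ t')
    (hg : ∀ y y', dist y y' ≤ t' → dist (g y) (g y') ≤ t'') :
    vietorisRipsMap f hf ≫ vietorisRipsMap g hg =
      vietorisRipsMap (g ∘ f) fun x x' h => hg _ _ (hf x x' h) := by
  ext1
  exact congrArg TopCat.ofHom (Realization.map_comp (isSimplicial_vietorisRips hg)
    (isSimplicial_vietorisRips hf)).symm

theorem vietorisRips_map_eq (h : t ⟶ t') :
    (vietorisRips X).map h = vietorisRipsMap id fun _ _ hx => hx.trans (leOfHom h) := by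
  ext1
  exact congrArg TopCat.ofHom (Realization.map_id (vietorisRipsComplex_mono X (leOfHom h))).symm

theorem isWeakEquiv_vietorisRipsMap {f : X → Y} (hf : Isometry f) (hs : Function.Surjective f) :
    CGWH.IsWeakEquiv (vietorisRipsMap (t := t) f fun x x' h => (hf.dist_eq x x').trans_le h) := by
  obtain ⟨g, hg⟩ := hs.hasRightInverse
  have hgd (y y' : Y) : dist (g y) (g y') = dist y y' := by rw [← hf.dist_eq, hg, hg]
  have hgf : IsContiguous (vietorisRipsComplex X t) (vietorisRipsComplex X t) (g ∘ f) id := by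
    refine isContiguous_vietorisRips (fun x x' h => ?_) (fun x x' h => h) fun x x' h => ?_
    · rwa [Function.comp_apply, Function.comp_apply, hgd, hf.dist_eq]
    · rwa [Function.comp_apply, id, ← hf.dist_eq, hg, hf.dist_eq]
  have hfg : IsContiguous (vietorisRipsComplex Y t) (vietorisRipsComplex Y t) (f ∘ g) id := by
    rw [hg.id]
    exact isContiguous_vietorisRips (fun _ _ h => h) (fun _ _ h => h) fun _ _ h => h
  exact IsWeakHomotopyEquiv.of_homotopyEquiv <| Realization.homotopyEquivOfContiguous
    (isSimplicial_vietorisRips fun x x' h => (hf.dist_eq x x').trans_le h)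
    (isSimplicial_vietorisRips fun y y' h => (hgd y y').trans_le h) hgf hfg

theorem weaklyEquivalent_vietorisRips {f : X → Y} (hf : Isometry f) (hs : Function.Surjective f) :
    WeaklyEquivalent (vietorisRips X) (vietorisRips Y) := by
  let φ : vietorisRips X ⟶ vietorisRips Y :=
    { app _ := vietorisRipsMap f fun x x' h => (hf.dist_eq x x').trans_le h
      naturality t t' h := by
        rw [vietorisRips_map_eq, vietorisRips_map_eq, vietorisRipsMap_comp, vietorisRipsMap_comp]
        rfl }
  exact ⟨vietorisRips X, 𝟙 _, φ, fun t =>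
    ⟨IsWeakHomotopyEquiv.id, isWeakEquiv_vietorisRipsMap hf hs⟩⟩

/-- The natural family `VR_t(X) ⟶ VR_{t + ε}(Y)` induced by a map that increases distances by at
most `ε`. -/
noncomputable def vietorisRipsShift (ε : ℝ≥0) (f : X → Y)
    (hf : ∀ x x', dist (f x) (f x') ≤ dist x x' + ε) :
    vietorisRips X ⟶ persistentShift ε (vietorisRips Y) where
  app t := vietorisRipsMap f fun x x' h => (hf x x').trans (add_le_add_left h (ε : ℝ))
  naturality t t' h := by
    dsimp only
    rw [vietorisRips_map_eq, vietorisRips_map_eq, vietorisRipsMap_comp, vietorisRipsMap_comp]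
    rfl

theorem isInterleaved_vietorisRips {ε : ℝ≥0} (e : X ≃ Y)
    (he : ∀ x x', |dist x x' - dist (e x) (e x')| ≤ ε) :
    IsInterleaved ε (vietorisRips X) (vietorisRips Y) := by
  have hXY (x x' : X) : dist (e x) (e x') ≤ dist x x' + ε := by
    linarith [abs_le.1 (he x x')]
  have hYX (y y' : Y) : dist (e.symm y) (e.symm y') ≤ dist y y' + ε := by
    have h := abs_le.1 (he (e.symm y) (e.symm y'))
    rw [e.apply_symm_apply, e.apply_symm_apply] at h
    linarith
  refine ⟨vietorisRipsShift ε e hXY, vietorisRipsShift ε e.symm hYX, fun t => ⟨?_, ?_⟩⟩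
  · dsimp only [vietorisRipsShift]
    rw [vietorisRips_map_eq, vietorisRipsMap_comp]
    simp only [e.symm_comp_self]
  · dsimp only [vietorisRipsShift]
    rw [vietorisRips_map_eq, vietorisRipsMap_comp]
    simp only [e.self_comp_symm]

theorem homotopyInterleavingDist_vietorisRips_le_of_equiv {R S : Type u} [PseudoMetricSpace R]
    [PseudoMetricSpace S] {π : R → X} {ρ : S → Y} (hπ : Isometry π)
    (hπ' : Function.Surjective π) (hρ : Isometry ρ) (hρ' : Function.Surjective ρ) {ε : ℝ≥0}
    (e : R ≃ S) (he : ∀ r r', |dist r r' - dist (e r) (e r')| ≤ ε) :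
    homotopyInterleavingDist (vietorisRips X) (vietorisRips Y) ≤ ε :=
  ((weaklyEquivalent_vietorisRips hπ hπ').homotopyInterleavingDist_le
    (weaklyEquivalent_vietorisRips hρ hρ')).trans
      (isInterleaved_vietorisRips e he).interleavingDist_le

theorem homotopyInterleavingDist_vietorisRips_le_of_surjective {R : Type u} {π : R → X} {ρ : R → Y}
    (hπ : Function.Surjective π) (hρ : Function.Surjective ρ) {ε : ℝ≥0}
    (h : ∀ r r', |dist (π r) (π r') - dist (ρ r) (ρ r')| ≤ ε) :
    homotopyInterleavingDist (vietorisRips X) (vietorisRips Y) ≤ ε :=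
  @homotopyInterleavingDist_vietorisRips_le_of_equiv X Y _ _ R R
    (.induced π inferInstance) (.induced ρ inferInstance) π ρ (fun _ _ => rfl) hπ
    (fun _ _ => rfl) hρ ε (Equiv.refl R) h

end VietorisRips

section GromovHausdorff

theorem exists_dist_le_hausdorffDist {M : Type*} [PseudoMetricSpace M] {s t : Set M}
    (hs : IsCompact s) (ht : IsCompact t) (ht' : t.Nonempty) {x : M} (hx : x ∈ s) :
    ∃ y ∈ t, dist x y ≤ Metric.hausdorffDist s t := by
  obtain ⟨y, hy, hxy⟩ := ht.exists_infDist_eq_dist ht' x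
  exact ⟨y, hy, hxy.symm.trans_le <| Metric.infDist_le_hausdorffDist_of_mem hx <|
    Metric.hausdorffEDist_ne_top_of_nonempty_of_bounded ⟨x, hx⟩ ht' hs.isBounded ht.isBounded⟩

theorem exists_correspondence_distortion_le_ghDist (X : Type u) (Y : Type v) [MetricSpace X]
    [CompactSpace X] [Nonempty X] [MetricSpace Y] [CompactSpace Y] [Nonempty Y] :
    ∃ R : Set (X × Y), (∀ x, ∃ y, (x, y) ∈ R) ∧ (∀ y, ∃ x, (x, y) ∈ R) ∧
      ∀ q ∈ R, ∀ q' ∈ R,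
        |dist q.1 q'.1 - dist q.2 q'.2| ≤ 2 * GromovHausdorff.ghDist X Y := by
  obtain ⟨Φ, Ψ, hΦ, hΨ, h⟩ := GromovHausdorff.ghDist_eq_hausdorffDist X Y
  have hX := isCompact_range hΦ.continuous
  have hY := isCompact_range hΨ.continuous
  rw [h]
  refine ⟨{q | dist (Φ q.1) (Ψ q.2) ≤ Metric.hausdorffDist (Set.range Φ) (Set.range Ψ)},
    fun x => ?_, fun y => ?_, fun q hq q' hq' => ?_⟩
  · obtain ⟨_, ⟨y, rfl⟩, hxy⟩ :=
      exists_dist_le_hausdorffDist hX hY (Set.range_nonempty Ψ) (Set.mem_range_self x)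
    exact ⟨y, hxy⟩
  · obtain ⟨_, ⟨x, rfl⟩, hxy⟩ :=
      exists_dist_le_hausdorffDist hY hX (Set.range_nonempty Φ) (Set.mem_range_self y)
    rw [dist_comm, Metric.hausdorffDist_comm] at hxy
    exact ⟨x, hxy⟩
  · rw [← hΦ.dist_eq, ← hΨ.dist_eq, two_mul]
    exact (dist_dist_dist_le _ _ _ _).trans (add_le_add hq hq')

theorem homotopyInterleavingDist_vietorisRips_le (X Y : Type u) [MetricSpace X] [CompactSpace X]
    [Nonempty X] [MetricSpace Y] [CompactSpace Y] [Nonempty Y] :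
    homotopyInterleavingDist (vietorisRips X) (vietorisRips Y) ≤
      2 * ENNReal.ofReal (GromovHausdorff.ghDist X Y) := by
  obtain ⟨R, hX, hY, hR⟩ := exists_correspondence_distortion_le_ghDist X Y
  have hπ : Function.Surjective fun q : R => q.1.1 := fun x =>
    let ⟨y, h⟩ := hX x
    ⟨⟨(x, y), h⟩, rfl⟩
  have hρ : Function.Surjective fun q : R => q.1.2 := fun y =>
    let ⟨x, h⟩ := hY y
    ⟨⟨(x, y), h⟩, rfl⟩
  have h₀ : 0 ≤ GromovHausdorff.ghDist X Y := dist_nonneg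
  have hε : 2 * GromovHausdorff.ghDist X Y =
      ((2 * (GromovHausdorff.ghDist X Y).toNNReal : ℝ≥0) : ℝ) := by
    rw [NNReal.coe_mul, NNReal.coe_ofNat, Real.coe_toNNReal _ h₀]
  refine (homotopyInterleavingDist_vietorisRips_le_of_surjective hπ hρ fun q q' =>
    (hR q q.2 q' q'.2).trans_eq hε).trans_eq ?_
  rw [ENNReal.coe_mul, ENNReal.coe_ofNat, ENNReal.ofReal]

end GromovHausdorff

theorem theorem2 {N : Type w} [PartialOrder N] (J : CategoricalInvariant CGWH.{u} N)
    (hJ : ∀ {X Y Z W : CGWH.{u}} (f : X ⟶ Y) (g : Y ⟶ Z) (h : Z ⟶ W), CGWH.IsWeakEquiv g →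
      J.map (f ≫ g) = J.map f ∧ J.map (g ≫ h) = J.map h) :
    (∀ X Y : ℝ ⥤ CGWH.{u},
      erosionDist (J.persistent X) (J.persistent Y) ≤ homotopyInterleavingDist X Y) ∧
    (∀ (X Y : Type u) [MetricSpace X] [CompactSpace X] [Nonempty X]
      [MetricSpace Y] [CompactSpace Y] [Nonempty Y],
      erosionDist (J.persistent (vietorisRips X)) (J.persistent (vietorisRips Y)) ≤
        2 * ENNReal.ofReal (GromovHausdorff.ghDist X Y)) := by
  have hHI (X Y : ℝ ⥤ CGWH.{u}) :
      erosionDist (J.persistent X) (J.persistent Y) ≤ homotopyInterleavingDist X Y :=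
    CategoricalInvariant.IsWeaklyInvariant.erosionDist_le_homotopyInterleavingDist hJ X Y
  exact ⟨hHI, fun X Y _ _ _ _ _ _ =>
    (hHI _ _).trans (homotopyInterleavingDist_vietorisRips_le X Y)⟩
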